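/- Let $1 < r < 2$, $1 \leqslant p < r$, and let $\{X_{n,k},\ 1 \leqslant k \leqslant n,\ n \geqslant 1\}$ be a triangular array of real random variables on a probability space $(\Omega,\mathcal F,\mathbb P)$ with $\mathbb{E}\,\lvert X_{n,k}\rvert^{r} < \infty$ for all $n \geqslant 1$ and $1 \leqslant k \leqslant n$. Suppose the array is row-wise pairwise negatively quadrant dependent (NQD), i.e. for every $n \geqslant 1$, all $1 \leqslant j \neq k \leqslant n$ and all $x,y \in \mathbb{R}$, $$\mathbb{P}\{X_{n,j} \leqslant x,\, X_{n,k} \leqslant y\} \leqslant \mathbb{P}\{X_{n,j} \leqslant x\}\,\mathbb{P}\{X_{n,k} \leqslant y\}.$$ Let $\{b_n\}_{n\geqslant 1}$ be a sequence of positive real numbers such that (1) $\displaystyle\sum_{n=1}^{\infty}\sum_{k=1}^{n} b_n^{-r}\int_0^{b_n^{r}} \mathbb{P}\{\lvert X_{n,k}\rvert^{r} > t\}\,\mathrm{d}t < \infty$, (2) $\displaystyle\sum_{n=1}^{\infty}\sum_{k=1}^{n} \frac{\mathbb{E}\,\lvert X_{n,k}\rvert I_{\{\lvert X_{n,k}\rvert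 > b_n\}}}{b_n} < \infty$, (3) $\displaystyle\sum_{n=1}^{\infty}\sum_{k=1}^{n} b_n^{-p}\int_{b_n^{p}}^{\infty} \mathbb{P}\{\lvert X_{n,k}\rvert^{p} > t\}\,\mathrm{d}t < \infty$, where $I_A$ denotes the indicator of the event $A$. Then, writing $x_+ = \max(x,0)$, $$\sum_{n=1}^{\infty} \mathbb{E}\left[\frac{\left\lvert\sum_{k=1}^{n}(X_{n,k} - \mathbb{E}\,X_{n,k})\right\rvert}{b_n} - \varepsilon\right]_+^{p} < \infty \quad\text{for all } \varepsilon > 0.$$ -/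

import Mathlib

open MeasureTheory
open scoped ENNReal

/-- Two real random variables are negatively quadrant dependent (NQD):
`P (X ≤ x, Y ≤ y) ≤ P (X ≤ x) P (Y ≤ y)` for all real `x`, `y`. -/
def NQD {Ω : Type*} [MeasurableSpace Ω] (μ : Measure Ω) (X Y : Ω → ℝ) : Prop :=
  ∀ x y : ℝ, μ {ω | X ω ≤ x ∧ Y ω ≤ y} ≤ μ {ω | X ω ≤ x} * μ {ω | Y ω ≤ y}

/-- A triangular array, with row `n ≥ 1` consisting of `n` random variables, is row-wise pairwise
NQD if any two variables at different positions of the same row are NQD. -/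
def RowwisePairwiseNQD {Ω : Type*} [MeasurableSpace Ω] (μ : Measure Ω)
    (X : (n : ℕ+) → Fin n → Ω → ℝ) : Prop :=
  ∀ (n : ℕ+) (j k : Fin n), j ≠ k → NQD μ (X n j) (X n k)

/-! Fix a row and clip every variable at level b = b_n. The clipped part and the overshoot are both
continuous monotone functions of X, so each family stays pairwise NQD (`NQD.comp_monotone`). With A,
B the two centred sums divided by b, `max_add_sub_rpow_le` gives (|A| + |B| - ε)₊^p ≤ C(ε) A² + 2^p
|B|^p: the margin ε lets a square replace a p-th power of A. NQD makes covariances of bounded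
variables nonpositive, so E A² is at most the sum of the clipped second moments over b², which the
series (1) controls. E |B|^p is handled by a von Bahr–Esseen inequality,
`lintegral_abs_sum_sub_integral_rpow_le`, and the overshoot moments by the series (3). The constants
do not depend on n, so the row bounds can be summed. -/

section

variable {Ω : Type*} [MeasurableSpace Ω] {μ : Measure Ω}

/-! ### Layer-cake formulas, and covariances under NQD -/

theorem lintegral_meas_lt_eq_lintegral_volume [SFinite μ] {W : Ω → ℝ} (hW : Measurable W)
    (S : Set ℝ) :
    ∫⁻ t in S, μ {ω | t < W ω} = ∫⁻ ω, volume (S ∩ Set.Iio (W ω)) ∂μ := by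
  have hA : MeasurableSet {z : Ω × ℝ | z.2 < W z.1} :=
    measurableSet_lt measurable_snd (hW.comp measurable_fst)
  have e1 := Measure.prod_apply (μ := μ) (ν := volume.restrict S) hA
  have e2 := Measure.prod_apply_symm (μ := μ) (ν := volume.restrict S) hA
  rw [e1] at e2
  refine Eq.trans e2.symm (lintegral_congr fun ω => ?_)
  have : Prod.mk ω ⁻¹' {z : Ω × ℝ | z.2 < W z.1} = Set.Iio (W ω) := rfl
  rw [this, Measure.restrict_apply measurableSet_Iio, Set.inter_comm]

theorem lintegral_meas_le_eq_lintegral_ofReal_sub [SFinite μ] {W : Ω → ℝ} (hW : Measurable W)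
    (M : ℝ) :
    ∫⁻ t in Set.Iio M, μ {ω | W ω ≤ t} = ∫⁻ ω, ENNReal.ofReal (M - W ω) ∂μ := by
  have hA : MeasurableSet {z : Ω × ℝ | W z.1 ≤ z.2} :=
    measurableSet_le (hW.comp measurable_fst) measurable_snd
  have e1 := Measure.prod_apply (μ := μ) (ν := volume.restrict (Set.Iio M)) hA
  have e2 := Measure.prod_apply_symm (μ := μ) (ν := volume.restrict (Set.Iio M)) hA
  rw [e1] at e2
  refine Eq.trans e2.symm (lintegral_congr fun ω => ?_)
  have : Prod.mk ω ⁻¹' {z : Ω × ℝ | W z.1 ≤ z.2} = Set.Ici (W ω) := rfl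
  rw [this, Measure.restrict_apply measurableSet_Ici, Set.Ici_inter_Iio, Real.volume_Ico]

/-- Hoeffding's device: (M - X)₊(M - Y)₊ is the area of {(s, t) : X ≤ s < M, Y ≤ t < M}. Tonelli
turns its expectation into an integral of P(X ≤ s, Y ≤ t), where NQD applies pointwise. -/
theorem NQD.lintegral_mul_le [SFinite μ] {X Y : Ω → ℝ} (h : NQD μ X Y)
    (hX : Measurable X) (hY : Measurable Y) (M : ℝ) :
    ∫⁻ ω, ENNReal.ofReal (M - X ω) * ENNReal.ofReal (M - Y ω) ∂μ ≤
      (∫⁻ ω, ENNReal.ofReal (M - X ω) ∂μ) * ∫⁻ ω, ENNReal.ofReal (M - Y ω) ∂μ := by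
  set ν : Measure ℝ := volume.restrict (Set.Iio M) with hν
  have hA : MeasurableSet {z : Ω × (ℝ × ℝ) | X z.1 ≤ z.2.1 ∧ Y z.1 ≤ z.2.2} :=
    (measurableSet_le (hX.comp measurable_fst) (measurable_fst.comp measurable_snd)).inter
      (measurableSet_le (hY.comp measurable_fst) (measurable_snd.comp measurable_snd))
  have e1 := Measure.prod_apply (μ := μ) (ν := ν.prod ν) hA
  have e2 := Measure.prod_apply_symm (μ := μ) (ν := ν.prod ν) hA
  rw [e1] at e2
  have e3 : ∀ ω, (ν.prod ν) (Prod.mk ω ⁻¹' {z : Ω × (ℝ × ℝ) | X z.1 ≤ z.2.1 ∧ Y z.1 ≤ z.2.2}) =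
      ENNReal.ofReal (M - X ω) * ENNReal.ofReal (M - Y ω) := fun ω => by
    have : Prod.mk ω ⁻¹' {z : Ω × (ℝ × ℝ) | X z.1 ≤ z.2.1 ∧ Y z.1 ≤ z.2.2} =
      Set.Ici (X ω) ×ˢ Set.Ici (Y ω) := rfl
    rw [this, Measure.prod_prod, hν, Measure.restrict_apply measurableSet_Ici,
      Measure.restrict_apply measurableSet_Ici, Set.Ici_inter_Iio, Set.Ici_inter_Iio,
      Real.volume_Ico, Real.volume_Ico]
  simp_rw [e3] at e2
  rw [e2, ← lintegral_meas_le_eq_lintegral_ofReal_sub hX,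
    ← lintegral_meas_le_eq_lintegral_ofReal_sub hY]
  have mono : ∀ W : Ω → ℝ, Measurable fun t => μ {ω | W ω ≤ t} := fun W =>
    Monotone.measurable fun s t hst => measure_mono fun ω hω => le_trans hω hst
  rw [← lintegral_prod_mul (mono X).aemeasurable (mono Y).aemeasurable]
  exact lintegral_mono fun z => h z.1 z.2

/-- The bound M makes M - X and M - Y equal to their positive parts, and Cov(M - X, M - Y) = Cov(X,
Y). -/
theorem NQD.covariance_nonpos [IsProbabilityMeasure μ] {X Y : Ω → ℝ} (h : NQD μ X Y)
    (hX : Measurable X) (hY : Measurable Y) {M : ℝ} (hXM : ∀ ω, |X ω| ≤ M)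
    (hYM : ∀ ω, |Y ω| ≤ M) : ProbabilityTheory.covariance X Y μ ≤ 0 := by
  have mem : ∀ W : Ω → ℝ, Measurable W → (∀ ω, |W ω| ≤ M) → MemLp W 2 μ := fun W hW hb =>
    MemLp.of_bound hW.aestronglyMeasurable M (.of_forall hb)
  have iX := (mem X hX hXM).integrable one_le_two
  have iY := (mem Y hY hYM).integrable one_le_two
  have iXY : Integrable (fun ω => X ω * Y ω) μ := (mem X hX hXM).integrable_mul (mem Y hY hYM)
  have nX : ∀ ω, 0 ≤ M - X ω := fun ω => by linarith [le_abs_self (X ω), hXM ω]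
  have nY : ∀ ω, 0 ≤ M - Y ω := fun ω => by linarith [le_abs_self (Y ω), hYM ω]
  have iX' : Integrable (fun ω => M - X ω) μ := (integrable_const M).sub iX
  have iY' : Integrable (fun ω => M - Y ω) μ := (integrable_const M).sub iY
  have expand : (fun ω => (M - X ω) * (M - Y ω)) =
      fun ω => M * (M - X ω) - M * Y ω + X ω * Y ω := by ext ω; ring
  have iXY' : Integrable (fun ω => (M - X ω) * (M - Y ω)) μ := by
    rw [expand]; exact ((iX'.const_mul M).sub (iY.const_mul M)).add iXY
  have key := h.lintegral_mul_le hX hY M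
  simp_rw [← ENNReal.ofReal_mul (nX _)] at key
  rw [← ofReal_integral_eq_lintegral_ofReal iXY' (.of_forall fun ω => mul_nonneg (nX ω) (nY ω)),
    ← ofReal_integral_eq_lintegral_ofReal iX' (.of_forall nX),
    ← ofReal_integral_eq_lintegral_ofReal iY' (.of_forall nY),
    ← ENNReal.ofReal_mul (integral_nonneg nX),
    ENNReal.ofReal_le_ofReal_iff (mul_nonneg (integral_nonneg nX) (integral_nonneg nY)),
    expand, integral_add (by exact (iX'.const_mul M).sub (iY.const_mul M)) iXY,
    integral_sub (iX'.const_mul M) (iY.const_mul M), integral_const_mul, integral_const_mul,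
    integral_sub (integrable_const M) iX, integral_sub (integrable_const M) iY] at key
  rw [ProbabilityTheory.covariance_eq_sub (mem X hX hXM) (mem Y hY hYM)]
  simp only [integral_const, probReal_univ, one_smul, Pi.mul_apply] at key ⊢
  nlinarith [key]

/-- A closed lower set of reals is empty, everything, or a closed half-line. -/
theorem IsLowerSet.eq_empty_or_univ_or_Iic {S : Set ℝ} (hS : IsLowerSet S) (hc : IsClosed S) :
    S = ∅ ∨ S = Set.univ ∨ ∃ a, S = Set.Iic a := by
  rcases S.eq_empty_or_nonempty with h | hne
  · exact .inl h
  by_cases hb : BddAbove S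
  · refine .inr (.inr ⟨sSup S, Set.Subset.antisymm (fun x hx => le_csSup hb hx) fun x hx => ?_⟩)
    exact hS hx (hc.csSup_mem hne hb)
  · refine .inr (.inl (Set.eq_univ_of_forall fun x => ?_))
    obtain ⟨y, hy, hxy⟩ := not_bddAbove_iff.1 hb x
    exact hS hxy.le hy

/-- Sublevel sets of f and g are empty, full or closed half-lines; the first two cases are trivial
and the last is NQD itself. -/
theorem NQD.comp_monotone [IsProbabilityMeasure μ] {X Y : Ω → ℝ} (h : NQD μ X Y) {f g : ℝ → ℝ}
    (hf : Monotone f) (hfc : Continuous f) (hg : Monotone g) (hgc : Continuous g) :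
    NQD μ (fun ω => f (X ω)) (fun ω => g (Y ω)) := by
  intro x y
  have aux : ∀ {f : ℝ → ℝ}, Monotone f → Continuous f → ∀ x, {u | f u ≤ x} = ∅ ∨
      {u | f u ≤ x} = Set.univ ∨ ∃ a, {u | f u ≤ x} = Set.Iic a := fun hf hfc x =>
    IsLowerSet.eq_empty_or_univ_or_Iic (fun u v huv (hu : _ ≤ x) => (hf huv).trans hu)
      (isClosed_le hfc continuous_const)
  change μ ({ω | X ω ∈ {u | f u ≤ x} ∧ Y ω ∈ {u | g u ≤ y}}) ≤
    μ {ω | X ω ∈ {u | f u ≤ x}} * μ {ω | Y ω ∈ {u | g u ≤ y}}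
  rcases aux hf hfc x with hx | hx | ⟨a, hx⟩ <;> rcases aux hg hgc y with hy | hy | ⟨c, hy⟩ <;>
    rw [hx, hy]
  all_goals first | exact h a c | simp

theorem lintegral_sum_sub_integral_sq_le [IsProbabilityMeasure μ] {ι : Type*} [Fintype ι]
    {Y : ι → Ω → ℝ} (hY : ∀ k, Measurable (Y k)) (h : ∀ j k, j ≠ k → NQD μ (Y j) (Y k)) {M : ℝ}
    (hM : ∀ k ω, |Y k ω| ≤ M) :
    ∫⁻ ω, ENNReal.ofReal ((∑ k, (Y k ω - ∫ ω', Y k ω' ∂μ)) ^ 2) ∂μ ≤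
      ∑ k, ∫⁻ ω, ENNReal.ofReal (Y k ω ^ 2) ∂μ := by
  classical
  have mem : ∀ k, MemLp (Y k) 2 μ := fun k =>
    MemLp.of_bound (hY k).aestronglyMeasurable M (.of_forall (hM k))
  have memS : MemLp (∑ k, Y k) 2 μ := memLp_finsetSum' _ fun k _ => mem k
  have hvar : ProbabilityTheory.variance (∑ k, Y k) μ ≤
      ∑ k, ProbabilityTheory.variance (Y k) μ := by
    rw [ProbabilityTheory.variance_sum' fun k _ => mem k]
    refine Finset.sum_le_sum fun j _ => ?_
    rw [← Finset.add_sum_erase _ _ (Finset.mem_univ j),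
      ProbabilityTheory.covariance_self (hY j).aemeasurable]
    have : ∑ k ∈ Finset.univ.erase j, ProbabilityTheory.covariance (Y j) (Y k) μ ≤ 0 :=
      Finset.sum_nonpos fun k hk =>
        (h j k (Finset.ne_of_mem_erase hk).symm).covariance_nonpos (hY j) (hY k) (hM j) (hM k)
    linarith
  have e1 : ∫⁻ ω, ENNReal.ofReal ((∑ k, (Y k ω - ∫ ω', Y k ω' ∂μ)) ^ 2) ∂μ =
      ENNReal.ofReal (ProbabilityTheory.variance (∑ k, Y k) μ) := by
    rw [ProbabilityTheory.ofReal_variance memS, ProbabilityTheory.evariance_eq_lintegral_ofReal]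
    refine lintegral_congr fun ω => ?_
    simp only [Finset.sum_apply]
    rw [integral_finsetSum _ fun k _ => (mem k).integrable one_le_two, Finset.sum_sub_distrib]
  rw [e1]
  refine (ENNReal.ofReal_le_ofReal hvar).trans ?_
  rw [ENNReal.ofReal_sum_of_nonneg fun k _ => ProbabilityTheory.variance_nonneg _ _]
  refine Finset.sum_le_sum fun k _ => ?_
  rw [← ofReal_integral_eq_lintegral_ofReal (mem k).integrable_sq
    (.of_forall fun ω => sq_nonneg _)]
  exact ENNReal.ofReal_le_ofReal
    (ProbabilityTheory.variance_le_expectation_sq (hY k).aestronglyMeasurable)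

/-! ### Clipping and its overshoot -/

/-- Truncation of a real number to the interval `[-s, s]`. -/
def clip (s x : ℝ) : ℝ := max (-s) (min x s)

theorem clip_monotone (s : ℝ) : Monotone (clip s) := fun _ _ h =>
  max_le_max le_rfl (min_le_min h le_rfl)

theorem clip_continuous (s : ℝ) : Continuous (clip s) := by unfold clip; fun_prop

theorem sub_clip_monotone (s : ℝ) : Monotone fun x => x - clip s x := by
  intro x y h
  simp only [clip]
  rcases max_cases (-s) (min x s) with ⟨h1, _⟩ | ⟨h1, _⟩ <;>
  rcases max_cases (-s) (min y s) with ⟨h2, _⟩ | ⟨h2, _⟩ <;>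
  rcases min_cases x s with ⟨h3, _⟩ | ⟨h3, _⟩ <;>
  rcases min_cases y s with ⟨h4, _⟩ | ⟨h4, _⟩ <;> linarith

theorem sub_clip_continuous (s : ℝ) : Continuous fun x => x - clip s x :=
  continuous_id.sub (clip_continuous s)

theorem abs_clip {s : ℝ} (hs : 0 ≤ s) (x : ℝ) : |clip s x| = min |x| s := by
  simp only [clip]; grind

theorem abs_sub_clip {s : ℝ} (hs : 0 ≤ s) (x : ℝ) : |x - clip s x| = max (|x| - s) 0 := by
  simp only [clip]; grind

/-- Triangle inequality only, with no dependence assumption; the 2 pays for centring. -/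
theorem lintegral_abs_sum_sub_integral_le [IsProbabilityMeasure μ] {ι : Type*} [Fintype ι]
    {Z : ι → Ω → ℝ} (hZ : ∀ k, Measurable (Z k)) :
    ∫⁻ ω, ENNReal.ofReal |∑ k, (Z k ω - ∫ ω', Z k ω' ∂μ)| ∂μ ≤
      2 * ∑ k, ∫⁻ ω, ENNReal.ofReal |Z k ω| ∂μ := by
  simp_rw [← Real.enorm_eq_ofReal_abs]
  calc ∫⁻ ω, ‖∑ k, (Z k ω - ∫ ω', Z k ω' ∂μ)‖ₑ ∂μ
      ≤ ∫⁻ ω, ∑ k, (‖Z k ω‖ₑ + ‖∫ ω', Z k ω' ∂μ‖ₑ) ∂μ :=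
        lintegral_mono fun ω => (enorm_sum_le _ _).trans
          (Finset.sum_le_sum fun k _ => enorm_sub_le)
    _ = ∑ k, (∫⁻ ω, ‖Z k ω‖ₑ ∂μ + ‖∫ ω', Z k ω' ∂μ‖ₑ) := by
        rw [lintegral_finsetSum _ fun k _ => ((hZ k).enorm.add_const _)]
        refine Finset.sum_congr rfl fun k _ => ?_
        rw [lintegral_add_left (hZ k).enorm]; simp
    _ ≤ ∑ k, (∫⁻ ω, ‖Z k ω‖ₑ ∂μ + ∫⁻ ω, ‖Z k ω‖ₑ ∂μ) :=
        Finset.sum_le_sum fun k _ => add_le_add le_rfl (enorm_integral_le_lintegral_enorm _)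
    _ = 2 * ∑ k, ∫⁻ ω, ‖Z k ω‖ₑ ∂μ := by
        rw [Finset.mul_sum]; exact Finset.sum_congr rfl fun k _ => (two_mul _).symm

/-! ### A von Bahr–Esseen inequality -/

/-- The contribution of a variable of absolute value `z` to the tail bound at level `s`:
Chebyshev's inequality for the part clipped at `s`, Markov's inequality for the rest. -/
noncomputable def tailWeight (s z : ℝ) : ℝ := 4 / s ^ 2 * min z s ^ 2 + 4 / s * max (z - s) 0

theorem tailWeight_nonneg {s : ℝ} (hs : 0 < s) (z : ℝ) : 0 ≤ tailWeight s z := by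
  unfold tailWeight; positivity

theorem measurable_tailWeight : Measurable fun x : ℝ × ℝ => tailWeight x.1 x.2 := by
  unfold tailWeight; fun_prop

theorem tailWeight_mul_rpow_le {s z : ℝ} (hs : 0 < s) (hsz : s ≤ z) (q : ℝ) :
    tailWeight s z * s ^ (q - 1) ≤ 4 * s ^ (q - 1) + 4 * z * s ^ (q - 2) := by
  have e : s ^ (q - 1) = s ^ (q - 2) * s := by
    rw [← Real.rpow_add_one hs.ne']; ring_nf
  have hp : 0 < s ^ (q - 2) := Real.rpow_pos_of_pos hs _
  have hw : tailWeight s z = 4 + 4 / s * (z - s) := by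
    rw [tailWeight, min_eq_right hsz, max_eq_left (by linarith)]; field_simp
  have : tailWeight s z * s ^ (q - 1) = 4 * s ^ (q - 1) + 4 * z * s ^ (q - 2) -
      4 * s * s ^ (q - 2) := by
    rw [hw, e]; field_simp; ring
  rw [this]; nlinarith [mul_pos hs hp]

theorem tailWeight_mul_rpow_eq {s z : ℝ} (hs : 0 < s) (hsz : z ≤ s) (q : ℝ) :
    tailWeight s z * s ^ (q - 1) = 4 * z ^ 2 * s ^ (q - 3) := by
  have e : s ^ (q - 1) = s ^ (q - 3) * s ^ 2 := by
    rw [← Real.rpow_natCast, ← Real.rpow_add hs]; norm_num; ring_nf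
  rw [tailWeight, min_eq_left hsz, max_eq_right (by linarith), e]; field_simp; ring

/-- Split at s = z. Below, the integrand is at most 4s^(q-1) + 4z s^(q-2), integrable at 0 because q
> 1; above, it is 4z² s^(q-3), integrable at ∞ because q < 2. -/
theorem lintegral_tailWeight_le {q : ℝ} (hq1 : 1 < q) (hq2 : q < 2) {z : ℝ} (hz : 0 ≤ z) :
    ∫⁻ s in Set.Ioi 0, ENNReal.ofReal (tailWeight s z) * ENNReal.ofReal (s ^ (q - 1)) ≤
      ENNReal.ofReal (4 / q + 4 / (q - 1) + 4 / (2 - q)) * ENNReal.ofReal (z ^ q) := by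
  have hmul : ∀ s ∈ Set.Ioi (0 : ℝ), ENNReal.ofReal (tailWeight s z) * ENNReal.ofReal (s ^ (q - 1))
      = ENNReal.ofReal (tailWeight s z * s ^ (q - 1)) := fun s hs =>
    (ENNReal.ofReal_mul (tailWeight_nonneg hs z)).symm
  rw [setLIntegral_congr_fun measurableSet_Ioi hmul]
  rcases hz.eq_or_lt with rfl | hz
  · have : ∀ s ∈ Set.Ioi (0 : ℝ), ENNReal.ofReal (tailWeight s 0 * s ^ (q - 1)) = 0 :=
      fun s hs => by rw [tailWeight_mul_rpow_eq hs (le_of_lt hs)]; simp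
    rw [setLIntegral_congr_fun measurableSet_Ioi this]; simp
  have i1 : ∀ {a : ℝ}, -1 < a → IntegrableOn (fun s : ℝ => s ^ a) (Set.Ioc 0 z) := fun ha =>
    (intervalIntegrable_iff_integrableOn_Ioc_of_le hz.le).1
      (intervalIntegral.intervalIntegrable_rpow' ha)
  have v1 : ∀ {a : ℝ}, -1 < a → ∫ s in Set.Ioc 0 z, s ^ a = z ^ (a + 1) / (a + 1) := fun ha => by
    rw [← intervalIntegral.integral_of_le hz.le, integral_rpow (.inl ha),
      Real.zero_rpow (by linarith), sub_zero]
  rw [← Set.Ioc_union_Ioi_eq_Ioi hz.le,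
    lintegral_union measurableSet_Ioi (Set.Ioc_disjoint_Ioi le_rfl)]
  have b1 : ∫⁻ s in Set.Ioc 0 z, ENNReal.ofReal (tailWeight s z * s ^ (q - 1)) ≤
      ENNReal.ofReal ((4 / q + 4 / (q - 1)) * z ^ q) := by
    calc _ ≤ ∫⁻ s in Set.Ioc 0 z, ENNReal.ofReal (4 * s ^ (q - 1) + 4 * z * s ^ (q - 2)) :=
          setLIntegral_mono' measurableSet_Ioc fun s hs =>
            ENNReal.ofReal_le_ofReal (tailWeight_mul_rpow_le hs.1 hs.2 q)
      _ = ENNReal.ofReal (∫ s in Set.Ioc 0 z, (4 * s ^ (q - 1) + 4 * z * s ^ (q - 2))) := by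
          refine (ofReal_integral_eq_lintegral_ofReal
            (((i1 (by linarith)).const_mul 4).add ((i1 (by linarith)).const_mul (4 * z))) ?_).symm
          filter_upwards [ae_restrict_mem measurableSet_Ioc] with s hs
          have := hs.1
          change 0 ≤ 4 * s ^ (q - 1) + 4 * z * s ^ (q - 2)
          positivity
      _ = _ := by
          rw [integral_add ((i1 (by linarith)).const_mul 4)
            ((i1 (by linarith)).const_mul (4 * z)), integral_const_mul, integral_const_mul,
            v1 (by linarith), v1 (by linarith)]
          congr 1
          have e : z ^ q = z ^ (q - 1) * z := by rw [← Real.rpow_add_one hz.ne']; ring_nf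
          have h0 : q ≠ 0 := by linarith
          have h1 : q - 1 ≠ 0 := by linarith
          rw [show q - 1 + 1 = q by ring, show q - 2 + 1 = q - 1 by ring, e]
          field_simp
  have b2 : ∫⁻ s in Set.Ioi z, ENNReal.ofReal (tailWeight s z * s ^ (q - 1)) ≤
      ENNReal.ofReal (4 / (2 - q) * z ^ q) := by
    have hq3 : q - 3 < -1 := by linarith
    calc _ = ∫⁻ s in Set.Ioi z, ENNReal.ofReal (4 * z ^ 2 * s ^ (q - 3)) :=
          setLIntegral_congr_fun measurableSet_Ioi fun s (hs : z < s) => by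
            simp only [tailWeight_mul_rpow_eq (hz.trans hs) hs.le q]
      _ = ENNReal.ofReal (∫ s in Set.Ioi z, 4 * z ^ 2 * s ^ (q - 3)) := by
          refine (ofReal_integral_eq_lintegral_ofReal
            ((integrableOn_Ioi_rpow_of_lt hq3 hz).const_mul _) ?_).symm
          filter_upwards [ae_restrict_mem measurableSet_Ioi] with s hs
          have : 0 < s := hz.trans hs
          change 0 ≤ 4 * z ^ 2 * s ^ (q - 3)
          positivity
      _ ≤ _ := by
          rw [integral_const_mul, integral_Ioi_rpow_of_lt hq3 hz]
          refine ENNReal.ofReal_le_ofReal (le_of_eq ?_)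
          have e : z ^ q = z ^ (q - 2) * z ^ 2 := by
            rw [← Real.rpow_natCast, ← Real.rpow_add hz]; norm_num
          have h2 : 2 - q ≠ 0 := by linarith
          have h3 : q - 2 ≠ 0 := by linarith
          rw [show q - 3 + 1 = q - 2 by ring, e, show 2 - q = -(q - 2) by ring]
          field_simp
  have hq0 : 0 < q := by linarith
  have hq1' : 0 < q - 1 := by linarith
  have hq2' : 0 < 2 - q := by linarith
  refine (add_le_add b1 b2).trans (le_of_eq ?_)
  rw [← ENNReal.ofReal_add (by positivity) (by positivity), ← ENNReal.ofReal_mul (by positivity)]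
  ring_nf

theorem sum_sub_integral_eq_clip_add {ι : Type*} [Fintype ι] [IsProbabilityMeasure μ]
    {Z : ι → Ω → ℝ} (hi : ∀ k, Integrable (Z k) μ) {s : ℝ} (hs : 0 ≤ s) (ω : Ω) :
    ∑ k, (Z k ω - ∫ ω', Z k ω' ∂μ) =
      ∑ k, (clip s (Z k ω) - ∫ ω', clip s (Z k ω') ∂μ) +
        ∑ k, (Z k ω - clip s (Z k ω) - ∫ ω', (Z k ω' - clip s (Z k ω')) ∂μ) := by
  rw [← Finset.sum_add_distrib]
  refine Finset.sum_congr rfl fun k _ => ?_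
  have ic : Integrable (fun ω => clip s (Z k ω)) μ :=
    (hi k).mono ((clip_continuous s).comp_aestronglyMeasurable (hi k).aestronglyMeasurable)
      (.of_forall fun ω => by
        simp only [Real.norm_eq_abs, abs_clip hs]; exact min_le_left _ _)
  rw [integral_sub (hi k) ic]; ring

/-- The clipping level is the tail level s itself. One of the two centred sums must reach s/2:
Chebyshev treats the clipped one, Markov the overshoot. -/
theorem meas_lt_abs_sum_sub_integral_le [IsProbabilityMeasure μ] {ι : Type*} [Fintype ι]
    {Z : ι → Ω → ℝ} (hZ : ∀ k, Measurable (Z k)) (hi : ∀ k, Integrable (Z k) μ)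
    (h : ∀ j k, j ≠ k → NQD μ (Z j) (Z k)) {s : ℝ} (hs : 0 < s) :
    μ {ω | s < |∑ k, (Z k ω - ∫ ω', Z k ω' ∂μ)|} ≤
      ∑ k, ∫⁻ ω, ENNReal.ofReal (tailWeight s |Z k ω|) ∂μ := by
  set A : Ω → ℝ := fun ω => ∑ k, (clip s (Z k ω) - ∫ ω', clip s (Z k ω') ∂μ) with hA
  set B : Ω → ℝ := fun ω =>
    ∑ k, (Z k ω - clip s (Z k ω) - ∫ ω', (Z k ω' - clip s (Z k ω')) ∂μ) with hB
  have mc : ∀ k, Measurable fun ω => clip s (Z k ω) := fun k =>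
    (clip_continuous s).measurable.comp (hZ k)
  have md : ∀ k, Measurable fun ω => Z k ω - clip s (Z k ω) := fun k => (hZ k).sub (mc k)
  have mA : Measurable A := Finset.measurable_sum _ fun k _ => (mc k).sub_const _
  have mB : Measurable B := Finset.measurable_sum _ fun k _ => (md k).sub_const _
  have bA : μ {ω | ENNReal.ofReal (s ^ 2 / 4) ≤ ENNReal.ofReal (A ω ^ 2)} ≤
      ENNReal.ofReal (4 / s ^ 2) * ∑ k, ∫⁻ ω, ENNReal.ofReal (clip s (Z k ω) ^ 2) ∂μ := by
    refine (meas_ge_le_lintegral_div (mA.pow_const 2).ennreal_ofReal.aemeasurable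
      (ENNReal.ofReal_pos.2 (by positivity)).ne' ENNReal.ofReal_ne_top).trans ?_
    rw [ENNReal.div_eq_inv_mul, ← ENNReal.ofReal_inv_of_pos (by positivity), inv_div]
    gcongr
    exact lintegral_sum_sub_integral_sq_le mc
      (fun j k hjk => (h j k hjk).comp_monotone (clip_monotone s) (clip_continuous s)
        (clip_monotone s) (clip_continuous s))
      (fun k ω => (abs_clip hs.le _).trans_le (min_le_right _ _))
  have bB : μ {ω | ENNReal.ofReal (s / 2) ≤ ENNReal.ofReal |B ω|} ≤
      ENNReal.ofReal (4 / s) * ∑ k, ∫⁻ ω, ENNReal.ofReal |Z k ω - clip s (Z k ω)| ∂μ := by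
    refine (meas_ge_le_lintegral_div mB.abs.ennreal_ofReal.aemeasurable
      (by simpa using hs) ENNReal.ofReal_ne_top).trans ?_
    -- One factor 2 comes from Markov at s/2, the other from centring.
    have e : ENNReal.ofReal (4 / s) = ENNReal.ofReal (2 / s) * 2 := by
      rw [← ENNReal.ofReal_ofNat 2, ← ENNReal.ofReal_mul (by positivity)]; ring_nf
    rw [ENNReal.div_eq_inv_mul, ← ENNReal.ofReal_inv_of_pos (by positivity), inv_div, e, mul_assoc]
    gcongr
    exact lintegral_abs_sum_sub_integral_le md
  have hsub : {ω | s < |∑ k, (Z k ω - ∫ ω', Z k ω' ∂μ)|} ⊆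
      {ω | ENNReal.ofReal (s ^ 2 / 4) ≤ ENNReal.ofReal (A ω ^ 2)} ∪
        {ω | ENNReal.ofReal (s / 2) ≤ ENNReal.ofReal |B ω|} := by
    intro ω hω
    have hω' : s < |A ω + B ω| := by
      rw [hA, hB, ← sum_sub_integral_eq_clip_add hi hs.le ω]; exact hω
    have htri := abs_add_le (A ω) (B ω)
    by_cases hAs : s / 2 ≤ |A ω|
    · refine .inl (ENNReal.ofReal_le_ofReal ?_)
      rw [← sq_abs (A ω)]; nlinarith
    · exact .inr (ENNReal.ofReal_le_ofReal (by linarith))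
  refine ((measure_mono hsub).trans (measure_union_le _ _)).trans ((add_le_add bA bB).trans
    (le_of_eq ?_))
  rw [Finset.mul_sum, Finset.mul_sum, ← Finset.sum_add_distrib]
  refine Finset.sum_congr rfl fun k _ => ?_
  rw [← lintegral_const_mul _ ((mc k).pow_const 2).ennreal_ofReal,
    ← lintegral_const_mul _ (md k).abs.ennreal_ofReal,
    ← lintegral_add_left (((mc k).pow_const 2).ennreal_ofReal.const_mul _)]
  refine lintegral_congr fun ω => ?_
  rw [← ENNReal.ofReal_mul (by positivity), ← ENNReal.ofReal_mul (by positivity),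
    ← ENNReal.ofReal_add (by positivity) (by positivity), ← sq_abs (clip _ _), abs_clip hs.le,
    abs_sub_clip hs.le, tailWeight]

/-- A von Bahr–Esseen type inequality for pairwise NQD random variables. -/
theorem lintegral_abs_sum_sub_integral_rpow_le [IsProbabilityMeasure μ] {ι : Type*} [Fintype ι]
    {q : ℝ} (hq1 : 1 < q) (hq2 : q < 2)
    {Z : ι → Ω → ℝ} (hZ : ∀ k, Measurable (Z k)) (hi : ∀ k, Integrable (Z k) μ)
    (h : ∀ j k, j ≠ k → NQD μ (Z j) (Z k)) :
    ∫⁻ ω, ENNReal.ofReal (|∑ k, (Z k ω - ∫ ω', Z k ω' ∂μ)| ^ q) ∂μ ≤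
      ENNReal.ofReal q * ENNReal.ofReal (4 / q + 4 / (q - 1) + 4 / (2 - q)) *
        ∑ k, ∫⁻ ω, ENNReal.ofReal (|Z k ω| ^ q) ∂μ := by
  have hm : Measurable fun ω => |∑ k, (Z k ω - ∫ ω', Z k ω' ∂μ)| :=
    (Finset.measurable_sum _ fun k _ => (hZ k).sub_const _).abs
  -- Write the q-th moment as an integral of tails, so that the clipping level can vary with s.
  rw [lintegral_rpow_eq_lintegral_meas_lt_mul μ (.of_forall fun ω => abs_nonneg _)
    hm.aemeasurable (by linarith), mul_assoc]
  gcongr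
  have hj : ∀ k, Measurable fun x : ℝ × Ω =>
      ENNReal.ofReal (tailWeight x.1 |Z k x.2|) * ENNReal.ofReal (x.1 ^ (q - 1)) := fun k =>
    (measurable_tailWeight.comp (measurable_fst.prodMk
      ((hZ k).comp measurable_snd).abs)).ennreal_ofReal.mul
      (measurable_fst.pow_const _).ennreal_ofReal
  have hp : ∀ k, Measurable fun ω => ENNReal.ofReal (|Z k ω| ^ q) := fun k =>
    ((hZ k).abs.pow_const q).ennreal_ofReal
  calc _ ≤ ∫⁻ s in Set.Ioi 0, ∑ k, ∫⁻ ω, ENNReal.ofReal (tailWeight s |Z k ω|) *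
          ENNReal.ofReal (s ^ (q - 1)) ∂μ := by
        refine setLIntegral_mono' measurableSet_Ioi fun s hs => ?_
        refine (mul_le_mul_left (meas_lt_abs_sum_sub_integral_le hZ hi h hs) _).trans
          (le_of_eq ?_)
        rw [Finset.sum_mul]
        exact Finset.sum_congr rfl fun k _ =>
          (lintegral_mul_const' _ _ ENNReal.ofReal_ne_top).symm
    _ = ∑ k, ∫⁻ ω, (∫⁻ s in Set.Ioi 0, ENNReal.ofReal (tailWeight s |Z k ω|) *
          ENNReal.ofReal (s ^ (q - 1))) ∂μ := by
        rw [lintegral_finsetSum _ fun k _ => (hj k).lintegral_prod_right']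
        exact Finset.sum_congr rfl fun k _ => lintegral_lintegral_swap (hj k).aemeasurable
    _ ≤ ∑ k, ∫⁻ ω, ENNReal.ofReal (4 / q + 4 / (q - 1) + 4 / (2 - q)) *
          ENNReal.ofReal (|Z k ω| ^ q) ∂μ :=
        Finset.sum_le_sum fun k _ => lintegral_mono fun ω =>
          lintegral_tailWeight_le hq1 hq2 (abs_nonneg _)
    _ = _ := by
        rw [Finset.mul_sum]
        exact Finset.sum_congr rfl fun k _ => lintegral_const_mul _ (hp k)

/-- The term 4 / (q - 1) blows up at exponent 1, so p = 1 uses the triangle inequality instead. -/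
theorem exists_lintegral_abs_sum_sub_integral_rpow_le (μ : Measure Ω) [IsProbabilityMeasure μ]
    {p : ℝ} (hp1 : 1 ≤ p) (hp2 : p < 2) :
    ∃ C : ℝ≥0∞, C ≠ ∞ ∧ ∀ {ι : Type} [Fintype ι] {Z : ι → Ω → ℝ}, (∀ k, Measurable (Z k)) →
      (∀ k, Integrable (Z k) μ) → (∀ j k, j ≠ k → NQD μ (Z j) (Z k)) →
      ∫⁻ ω, ENNReal.ofReal (|∑ k, (Z k ω - ∫ ω', Z k ω' ∂μ)| ^ p) ∂μ ≤
        C * ∑ k, ∫⁻ ω, ENNReal.ofReal (|Z k ω| ^ p) ∂μ := by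
  rcases hp1.eq_or_lt with rfl | hp1
  · refine ⟨2, by simp, fun hZ _ _ => ?_⟩
    simpa only [Real.rpow_one] using lintegral_abs_sum_sub_integral_le hZ
  · exact ⟨_, ENNReal.mul_ne_top ENNReal.ofReal_ne_top ENNReal.ofReal_ne_top,
      fun hZ hi h => lintegral_abs_sum_sub_integral_rpow_le hp1 hp2 hZ hi h⟩

/-! ### The bound for one row -/

/-- If a - ε/2 ≤ c, the left base is at most 2c. Otherwise it is at most 2a with a > ε/2, and a^p =
a^(p-2) a² with p - 2 ≤ 0. -/
theorem max_add_sub_rpow_le {a c ε p : ℝ} (ha : 0 ≤ a) (hc : 0 ≤ c) (hε : 0 < ε)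
    (hp0 : 0 ≤ p) (hp2 : p ≤ 2) :
    max (a + c - ε) 0 ^ p ≤ 2 ^ p * (ε / 2) ^ (p - 2) * a ^ 2 + 2 ^ p * c ^ p := by
  have hε2 : 0 < ε / 2 := by positivity
  rcases le_or_gt (a - ε / 2) c with h | h
  · calc max (a + c - ε) 0 ^ p ≤ (2 * c) ^ p :=
          Real.rpow_le_rpow (le_max_right _ _) (max_le (by linarith) (by linarith)) hp0
      _ = 2 ^ p * c ^ p := Real.mul_rpow (by norm_num) hc
      _ ≤ _ := le_add_of_nonneg_left (by positivity)
  · have ha' : ε / 2 < a := by linarith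
    calc max (a + c - ε) 0 ^ p ≤ (2 * a) ^ p :=
          Real.rpow_le_rpow (le_max_right _ _) (max_le (by linarith) (by linarith)) hp0
      _ = 2 ^ p * (a ^ (p - 2) * a ^ 2) := by
          rw [Real.mul_rpow (by norm_num) ha, ← Real.rpow_natCast a 2,
            ← Real.rpow_add (hε2.trans ha')]
          norm_num
      _ ≤ 2 ^ p * ((ε / 2) ^ (p - 2) * a ^ 2) := by
          gcongr ?_ * (?_ * ?_)
          exact Real.rpow_le_rpow_of_nonpos hε2 ha'.le (by linarith)
      _ ≤ _ := by rw [← mul_assoc]; exact le_add_of_nonneg_right (by positivity)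

/-- For m = min(|X|, b), the ratio m/b is at most 1 and r ≤ 2, so (m/b)² ≤ (m/b)^r; the truncated
tail integral dominates E m^r. -/
theorem lintegral_clip_sq_le [IsProbabilityMeasure μ] {X : Ω → ℝ} (hX : Measurable X) {b r : ℝ}
    (hb : 0 < b) (hr0 : 0 < r) (hr2 : r ≤ 2) :
    ENNReal.ofReal ((b ^ 2)⁻¹) * ∫⁻ ω, ENNReal.ofReal (clip b (X ω) ^ 2) ∂μ ≤
      ENNReal.ofReal (b ^ (-r)) * ∫⁻ t in Set.Ioc 0 (b ^ r), μ {ω | t < |X ω| ^ r} := by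
  rw [lintegral_meas_lt_eq_lintegral_volume (hX.abs.pow_const r),
    ← lintegral_const_mul' _ _ ENNReal.ofReal_ne_top,
    ← lintegral_const_mul' _ _ ENNReal.ofReal_ne_top]
  refine lintegral_mono fun ω => ?_
  set m := min |X ω| b with hm
  have hm0 : 0 ≤ m := le_min (abs_nonneg _) hb.le
  have hvol : ENNReal.ofReal (m ^ r) ≤ volume (Set.Ioc 0 (b ^ r) ∩ Set.Iio (|X ω| ^ r)) := by
    have : Set.Ioo 0 (m ^ r) ⊆ Set.Ioc 0 (b ^ r) ∩ Set.Iio (|X ω| ^ r) := fun t ht =>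
      ⟨⟨ht.1, ht.2.le.trans (Real.rpow_le_rpow hm0 (min_le_right _ _) hr0.le)⟩,
        ht.2.trans_le (Real.rpow_le_rpow hm0 (min_le_left _ _) hr0.le)⟩
    simpa using measure_mono (μ := volume) this
  refine le_trans ?_ (mul_le_mul_right hvol _)
  rw [← ENNReal.ofReal_mul (by positivity), ← ENNReal.ofReal_mul (by positivity)]
  refine ENNReal.ofReal_le_ofReal ?_
  rw [← sq_abs (clip _ _), abs_clip hb.le, ← hm, Real.rpow_neg hb.le, ← div_eq_inv_mul, ← div_eq_inv_mul,
    ← div_pow, ← Real.div_rpow hm0 hb.le, ← Real.rpow_natCast]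
  exact Real.rpow_le_rpow_of_exponent_ge' (by positivity)
    ((div_le_one hb).2 (min_le_right _ _)) hr0.le (by exact_mod_cast hr2)

/-- Superadditivity of x ↦ x^p for p ≥ 1: (|X| - b)^p ≤ |X|^p - b^p when |X| ≥ b. -/
theorem lintegral_sub_clip_rpow_le [IsProbabilityMeasure μ] {X : Ω → ℝ} (hX : Measurable X)
    {b p : ℝ} (hb : 0 < b) (hp : 1 ≤ p) :
    ∫⁻ ω, ENNReal.ofReal (|X ω - clip b (X ω)| ^ p) ∂μ ≤
      ∫⁻ t in Set.Ioi (b ^ p), μ {ω | t < |X ω| ^ p} := by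
  rw [lintegral_meas_lt_eq_lintegral_volume (hX.abs.pow_const p)]
  refine lintegral_mono fun ω => ?_
  rw [Set.Ioi_inter_Iio, Real.volume_Ioo, abs_sub_clip hb.le]
  rcases le_total |X ω| b with h | h
  · rw [max_eq_right (by linarith), Real.zero_rpow (by linarith)]; simp
  · rw [max_eq_left (by linarith)]
    have := Real.add_rpow_le_rpow_add (sub_nonneg.2 h) hb.le hp
    rw [sub_add_cancel] at this
    exact ENNReal.ofReal_le_ofReal (by linarith)

theorem exists_lintegral_max_abs_sum_sub_rpow_le (μ : Measure Ω) [IsProbabilityMeasure μ]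
    {r p ε : ℝ} (hr0 : 0 < r) (hr2 : r ≤ 2) (hp1 : 1 ≤ p) (hp2 : p < 2) (hε : 0 < ε) :
    ∃ C D : ℝ≥0∞, C ≠ ∞ ∧ D ≠ ∞ ∧ ∀ {ι : Type} [Fintype ι] {X : ι → Ω → ℝ} {b : ℝ}, 0 < b →
      (∀ k, Measurable (X k)) → (∀ k, Integrable (X k) μ) →
      (∀ j k, j ≠ k → NQD μ (X j) (X k)) →
      ∫⁻ ω, ENNReal.ofReal (max (|∑ k, (X k ω - ∫ ω', X k ω' ∂μ)| / b - ε) 0 ^ p) ∂μ ≤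
        C * (∑ k, ENNReal.ofReal (b ^ (-r)) *
          ∫⁻ t in Set.Ioc 0 (b ^ r), μ {ω | t < |X k ω| ^ r}) +
        D * ∑ k, ENNReal.ofReal (b ^ (-p)) *
          ∫⁻ t in Set.Ioi (b ^ p), μ {ω | t < |X k ω| ^ p} := by
  obtain ⟨K, hK, hKle⟩ := exists_lintegral_abs_sum_sub_integral_rpow_le μ hp1 hp2
  refine ⟨ENNReal.ofReal (2 ^ p * (ε / 2) ^ (p - 2)), ENNReal.ofReal (2 ^ p) * K,
    ENNReal.ofReal_ne_top, ENNReal.mul_ne_top ENNReal.ofReal_ne_top hK, ?_⟩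
  intro ι _ X b hb hX hi h
  set A : Ω → ℝ := fun ω => ∑ k, (clip b (X k ω) - ∫ ω', clip b (X k ω') ∂μ) with hA
  set B : Ω → ℝ := fun ω =>
    ∑ k, (X k ω - clip b (X k ω) - ∫ ω', (X k ω' - clip b (X k ω')) ∂μ) with hB
  have mc : ∀ k, Measurable fun ω => clip b (X k ω) := fun k =>
    (clip_continuous b).measurable.comp (hX k)
  have md : ∀ k, Measurable fun ω => X k ω - clip b (X k ω) := fun k => (hX k).sub (mc k)
  have mA : Measurable A := Finset.measurable_sum _ fun k _ => (mc k).sub_const _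
  have bA : ∫⁻ ω, ENNReal.ofReal (A ω ^ 2) ∂μ ≤
      ∑ k, ∫⁻ ω, ENNReal.ofReal (clip b (X k ω) ^ 2) ∂μ :=
    lintegral_sum_sub_integral_sq_le mc
      (fun j k hjk => (h j k hjk).comp_monotone (clip_monotone b) (clip_continuous b)
        (clip_monotone b) (clip_continuous b))
      (fun k ω => (abs_clip hb.le _).trans_le (min_le_right _ _))
  have bB : ∫⁻ ω, ENNReal.ofReal (|B ω| ^ p) ∂μ ≤
      K * ∑ k, ∫⁻ ω, ENNReal.ofReal (|X k ω - clip b (X k ω)| ^ p) ∂μ :=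
    hKle md (fun k => (hi k).mono (md k).aestronglyMeasurable (.of_forall fun ω => by
        simp only [Real.norm_eq_abs, abs_sub_clip hb.le]
        exact max_le (by linarith) (abs_nonneg _)))
      (fun j k hjk => (h j k hjk).comp_monotone (sub_clip_monotone b) (sub_clip_continuous b)
        (sub_clip_monotone b) (sub_clip_continuous b))
  have point : ∀ ω, ENNReal.ofReal (max (|∑ k, (X k ω - ∫ ω', X k ω' ∂μ)| / b - ε) 0 ^ p) ≤
      ENNReal.ofReal (2 ^ p * (ε / 2) ^ (p - 2)) *
        (ENNReal.ofReal ((b ^ 2)⁻¹) * ENNReal.ofReal (A ω ^ 2)) +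
      ENNReal.ofReal (2 ^ p) * (ENNReal.ofReal (b ^ (-p)) * ENNReal.ofReal (|B ω| ^ p)) := by
    intro ω
    have e1 : (b ^ 2)⁻¹ * A ω ^ 2 = (|A ω| / b) ^ 2 := by rw [div_pow, sq_abs, div_eq_inv_mul]
    have e2 : b ^ (-p) * |B ω| ^ p = (|B ω| / b) ^ p := by
      rw [Real.div_rpow (abs_nonneg _) hb.le, Real.rpow_neg hb.le, div_eq_inv_mul]
    rw [← ENNReal.ofReal_mul (by positivity), ← ENNReal.ofReal_mul (by positivity),
      ← ENNReal.ofReal_mul (by positivity), ← ENNReal.ofReal_mul (by positivity), e1, e2,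
      ← ENNReal.ofReal_add (by positivity) (by positivity)]
    refine ENNReal.ofReal_le_ofReal (le_trans ?_ (max_add_sub_rpow_le (by positivity)
      (by positivity) hε (by linarith) hp2.le))
    rw [sum_sub_integral_eq_clip_add hi hb.le ω, ← add_div]
    have htri := div_le_div_of_nonneg_right (abs_add_le (A ω) (B ω)) hb.le
    exact Real.rpow_le_rpow (le_max_right _ _)
      (max_le_max (sub_le_sub_right htri ε) le_rfl) (by linarith)
  refine (lintegral_mono point).trans ?_
  rw [lintegral_add_left (((mA.pow_const 2).ennreal_ofReal.const_mul _).const_mul _),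
    lintegral_const_mul' _ _ ENNReal.ofReal_ne_top, lintegral_const_mul' _ _ ENNReal.ofReal_ne_top,
    lintegral_const_mul' _ _ ENNReal.ofReal_ne_top, lintegral_const_mul' _ _ ENNReal.ofReal_ne_top,
    mul_assoc _ K]
  refine add_le_add (mul_le_mul_right ?_ _) (mul_le_mul_right ?_ _)
  · refine (mul_le_mul_right bA _).trans ?_
    rw [Finset.mul_sum]
    exact Finset.sum_le_sum fun k _ => lintegral_clip_sq_le (hX k) hb hr0 hr2
  · refine (mul_le_mul_right bB _).trans ?_
    rw [mul_left_comm, Finset.mul_sum]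
    gcongr with k
    exact lintegral_sub_clip_rpow_le (hX k) hb hp1

end

/-! ### Summation over the rows -/

theorem mainTheorem11 {Ω : Type*} [MeasurableSpace Ω] (μ : Measure Ω) [IsProbabilityMeasure μ]
    (r p : ℝ) (hr1 : 1 < r) (hr2 : r < 2) (hp1 : 1 ≤ p) (hpr : p < r)
    (X : (n : ℕ+) → Fin n → Ω → ℝ)
    (hmeas : ∀ (n : ℕ+) (k : Fin n), Measurable (X n k))
    (hnqd : RowwisePairwiseNQD μ X)
    (hmom : ∀ (n : ℕ+) (k : Fin n), Integrable (fun ω => |X n k ω| ^ r) μ)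
    (b : ℕ+ → ℝ) (hb : ∀ n, 0 < b n)
    (h1 : ∑' n : ℕ+, ∑ k : Fin n, ENNReal.ofReal (b n ^ (-r)) *
      ∫⁻ t in Set.Ioc 0 (b n ^ r), μ {ω | t < |X n k ω| ^ r} < ∞)
    (h2 : ∑' n : ℕ+, ∑ k : Fin n,
      (∫⁻ ω, ENNReal.ofReal ({ω' | b n < |X n k ω'|}.indicator (fun ω' => |X n k ω'|) ω) ∂μ) /
        ENNReal.ofReal (b n) < ∞)
    (h3 : ∑' n : ℕ+, ∑ k : Fin n, ENNReal.ofReal (b n ^ (-p)) *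
      ∫⁻ t in Set.Ioi (b n ^ p), μ {ω | t < |X n k ω| ^ p} < ∞)
    (ε : ℝ) (hε : 0 < ε) :
    ∑' n : ℕ+, ∫⁻ ω, ENNReal.ofReal
      (max (|∑ k : Fin n, (X n k ω - ∫ ω', X n k ω' ∂μ)| / b n - ε) 0 ^ p) ∂μ < ∞ := by

  obtain ⟨C, D, hC, hD, hle⟩ := exists_lintegral_max_abs_sum_sub_rpow_le μ (r := r) (p := p)
    (by linarith) hr2.le hp1 (hpr.trans hr2) hε
  -- First moments exist because |x| ≤ |x|^r + 1.
  have hint : ∀ (n : ℕ+) (k : Fin n), Integrable (X n k) μ := fun n k => by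
    refine ((hmom n k).add (integrable_const 1)).mono (hmeas n k).aestronglyMeasurable
      (.of_forall fun ω => ?_)
    have h0 : 0 ≤ |X n k ω| ^ r := by positivity
    simp only [Pi.add_apply, Real.norm_eq_abs]
    rw [abs_of_nonneg (by positivity : 0 ≤ |X n k ω| ^ r + 1)]
    rcases le_total |X n k ω| 1 with h | h
    · linarith
    · linarith [Real.self_le_rpow_of_one_le h hr1.le]
  refine (ENNReal.tsum_le_tsum fun n => hle (hb n) (hmeas n) (hint n) (hnqd n)).trans_lt ?_
  rw [ENNReal.tsum_add, ENNReal.tsum_mul_left, ENNReal.tsum_mul_left]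
  exact ENNReal.add_lt_top.2 ⟨ENNReal.mul_lt_top hC.lt_top h1, ENNReal.mul_lt_top hD.lt_top h3⟩
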